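/- \textbf{Setting.} An instance $u$ of vertex-weighted online bipartite matching with stochastic rewards consists of a finite set $I$ of resources with weights $r_i\ge 0$, a finite set $T$ of arrivals that come in increasing order of their index, a set of edges $E\subseteq I\times T$, and a success probability $p_{it}\in[0,1]$ for every $(i,t)\in E$. If $t$ is matched to an available neighbour $i$, the match succeeds with probability $p_{it}$, independently of all other events; on success the reward $r_i$ is obtained and $i$ becomes unavailable, on failure $t$ departs, $i$ stays available and there is no reward. Each arrival is offered at most one resource. The instance has deterministic rewards if $p_{it}=1$ for all $(i,t)\in E$. A non-anticipative policy (possibly randomized) adaptively offers resources to arrivals, in any order, and learns the outcome of an offer only after making it; an offer that is not along an edge of the instance it is run on, or whose arrival or resource is no longer available, fails. A non-anticipative algorithm $\mathcal A$ (online or offline) assigns to each instance $u$ such a policy, and $\mathcal A(u)$ denotes its expected total reward on $u$. Let $\mathrm{OPT}(u)$ be the supremum of the expected total reward on $u$ over all non-anticipative policies. Perturbed Greedy, $\mathrm{ALG}$, draws $y_i$, $i\in I$, i.i.d. uniformly from $[0,1]$ and offers to each arrival $t$, in the given order, an available neighbour $i$ that maximizes $p_{it}r_i(1-e^{y_i-1})$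 (ties are broken by the smallest index). \textbf{Statement.} Let $\mathcal V$ be a set of instances, and let $\mathbb A$ be a class of non-anticipative algorithms that contains $\mathrm{ALG}$ and, for every $\nu\in\mathcal V$, an algorithm $\mathcal A$ with $\mathcal A(\nu)=\mathrm{OPT}(\nu)$. For every $\nu\in\mathcal V$ let $\mathcal D_\nu$ be a probability distribution over instances that is value preserving for $\mathbb A$, that is, \[\mathcal A(\nu)=\mathbb E_{u\sim\mathcal D_\nu}[\mathcal A(u)]\qquad\text{for all }\mathcal A\in\mathbb A,\] and that is supported only on instances with deterministic rewards. Then \[\inf_{\nu\in\mathcal V,\ \mathrm{OPT}(\nu)\neq 0}\frac{\mathrm{ALG}(\nu)}{\mathrm{OPT}(\nu)}\ \ge\ 1-\frac1e .\] -/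

import Mathlib

open MeasureTheory

noncomputable section

namespace OnlineMatching

/-- An instance of vertex-weighted online bipartite matching with stochastic rewards.
Resources and arrivals carry labels in `ℕ`; arrivals come in increasing order of their label.
`r i` is the weight of resource `i`, and `p i t` the success probability of the edge `(i, t)`. -/
structure Instance where
  resources : Finset ℕ
  arrivals : Finset ℕ
  edges : Finset (ℕ × ℕ)
  edges_subset : edges ⊆ resources ×ˢ arrivals
  r : ℕ → ℝ
  p : ℕ → ℕ → ℝ
  r_nonneg : ∀ i ∈ resources, 0 ≤ r i
  p_nonneg : ∀ i t, (i, t) ∈ edges → 0 ≤ p i t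
  p_le_one : ∀ i t, (i, t) ∈ edges → p i t ≤ 1

/-- Deterministic rewards: every edge succeeds with probability one. -/
def Instance.IsDeterministic (u : Instance) : Prop :=
  ∀ i t, (i, t) ∈ u.edges → u.p i t = 1

/-- A deterministic non-anticipative (adaptive, possibly offline) policy, as a finite decision tree:
at each step it halts or offers a resource `i` to an arrival `t`, in any order of arrivals; the
outcome of the offer is then revealed and decides how the policy continues. -/
inductive Policy where
  | halt : Policy
  | offer (i t : ℕ) (onSuccess onFailure : Policy) : Policy

namespace Policy

/-- The probability that an offer of `i` to `t` succeeds in `u`, when the arrivals in `used` have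
already been offered something and the resources in `taken` have already been matched successfully.
An offer that is not along an edge of `u`, or whose arrival or resource is no longer available,
is void and fails. -/
def successProb (u : Instance) (used taken : Finset ℕ) (i t : ℕ) : ℝ :=
  if (i, t) ∈ u.edges ∧ t ∉ used ∧ i ∉ taken then u.p i t else 0

/-- Expected reward that a policy still collects on `u`, from the state `(used, taken)`. -/
def valueFrom (u : Instance) : Finset ℕ → Finset ℕ → Policy → ℝ
  | _, _, halt => 0
  | used, taken, offer i t s f =>
      successProb u used taken i t *
          (u.r i + valueFrom u (insert t used) (insert i taken) s) +
        (1 - successProb u used taken i t) * valueFrom u (insert t used) taken f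

/-- Expected total reward of a deterministic policy on the instance `u`. -/
def value (u : Instance) (π : Policy) : ℝ := valueFrom u ∅ ∅ π

instance : MeasurableSpace Policy := ⊤

instance : DiscreteMeasurableSpace Policy := ⟨fun _ => trivial⟩

/-- An injective coding of decision trees by natural numbers. -/
def code : Policy → ℕ
  | halt => 0
  | offer i t s f => Nat.pair (Nat.pair i t) (Nat.pair (code s) (code f)) + 1

theorem code_injective : Function.Injective code := by
  intro a
  induction a with
  | halt => intro b h; cases b <;> simp_all [code]
  | offer i t s f hs hf =>
    intro b h
    cases b with
    | halt => simp [code] at h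
    | offer i' t' s' f' =>
      simp only [code, Nat.add_right_cancel_iff, Nat.pair_eq_pair] at h
      obtain ⟨⟨rfl, rfl⟩, h1, h2⟩ := h
      rw [hs h1, hf h2]

instance : Countable Policy := code_injective.countable

end Policy

/-- A (randomized) non-anticipative algorithm, online or offline: to every instance it assigns a
probability distribution over deterministic non-anticipative policies. -/
abbrev Algorithm := Instance → ProbabilityMeasure Policy

/-- Expected total reward of a randomized policy on `u`, over the internal randomness of the
policy and the random outcomes of the matches. -/
def randValue (μ : ProbabilityMeasure Policy) (u : Instance) : ℝ :=
  ∫ π, π.value u ∂(μ : Measure Policy)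

/-- The expected total reward `𝒜(u)` of the algorithm `A` on the instance `u`. -/
def Algorithm.value (A : Algorithm) (u : Instance) : ℝ := randValue (A u) u

/-- The non-anticipative offline benchmark `OPT(u)`: the optimal expected total reward over all
randomized non-anticipative policies, which may depend on `u` and use the arrivals in any order. -/
def opt (u : Instance) : ℝ := ⨆ μ : ProbabilityMeasure Policy, randValue μ u

namespace PerturbedGreedy

/-- The perturbed expected reward `p i t * r i * (1 - exp (y i - 1))` of the edge `(i, t)`. -/
def weight (u : Instance) (y : u.resources → unitInterval) (t : ℕ) (i : u.resources) : ℝ :=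
  u.p i t * u.r i * (1 - Real.exp ((y i : ℝ) - 1))

/-- The neighbours of `t` among the available resources `S`, by increasing label. -/
def candidates (u : Instance) (S : Finset u.resources) (t : ℕ) : List u.resources :=
  (S.filter fun i : u.resources => ((i : ℕ), t) ∈ u.edges).sort (· ≤ ·)

/-- The available neighbour of `t` of maximum perturbed expected reward
(the first one, if there are ties), if `t` has an available neighbour. -/
def choice (u : Instance) (y : u.resources → unitInterval) (S : Finset u.resources) (t : ℕ) :
    Option u.resources :=
  (candidates u S t).argmax (weight u y t)

/-- Perturbed Greedy with seeds `y` on a list of arrivals, where `S` is the set of available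
resources: offer the choice to each arrival, and remove it from `S` if the match succeeds. -/
def run (u : Instance) (y : u.resources → unitInterval) :
    List ℕ → Finset u.resources → Policy
  | [], _ => Policy.halt
  | t :: l, S =>
    match choice u y S t with
    | none => run u y l S
    | some i => Policy.offer i t (run u y l (S.erase i)) (run u y l S)

/-- Perturbed Greedy with the seeds `y`: all resources are available at the start, and the
arrivals come in increasing order. -/
def policy (u : Instance) (y : u.resources → unitInterval) : Policy :=
  run u y (u.arrivals.sort (· ≤ ·)) Finset.univ

theorem measurable_weight (u : Instance) (t : ℕ) (i : u.resources) :
    Measurable fun y : u.resources → unitInterval => weight u y t i := by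
  unfold weight
  fun_prop

theorem measurableSet_choice (u : Instance) (S : Finset u.resources) (t : ℕ)
    (o : Option u.resources) : MeasurableSet {y | choice u y S t = o} := by
  have hs : ∀ i : u.resources, MeasurableSet {y | choice u y S t = some i} := by
    intro i
    have hle : ∀ a b : u.resources,
        Measurable fun y : u.resources → unitInterval => weight u y t a ≤ weight u y t b :=
      fun a b => measurableSet_setOfPred.1
        (measurableSet_le (measurable_weight u t a) (measurable_weight u t b))
    simp only [choice, List.argmax_eq_some_iff]
    refine measurableSet_setOfPred.2 (Measurable.and measurable_const (Measurable.and ?_ ?_))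
    · exact Measurable.forall fun a => Measurable.imp measurable_const (hle a i)
    · exact Measurable.forall fun a => Measurable.imp measurable_const
        (Measurable.imp (hle i a) measurable_const)
  cases o with
  | some i => exact hs i
  | none =>
    have h : {y | choice u y S t = none} = (⋃ i, {y | choice u y S t = some i})ᶜ := by
      ext y
      simp [Option.eq_none_iff_forall_ne_some]
    rw [h]
    exact (MeasurableSet.iUnion hs).compl

theorem measurable_run (u : Instance) (l : List ℕ) :
    ∀ S : Finset u.resources, Measurable fun y => run u y l S := by
  induction l with
  | nil => intro S; exact measurable_const
  | cons t l ih =>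
    intro S A _
    let F : Option u.resources → (u.resources → unitInterval) → Policy := fun o y =>
      match o with
      | none => run u y l S
      | some i => Policy.offer i t (run u y l (S.erase i)) (run u y l S)
    have hF : ∀ o, Measurable (F o) := by
      intro o
      cases o with
      | none => exact ih S
      | some i =>
        exact (Measurable.of_discrete (f := fun q : Policy × Policy =>
          Policy.offer i t q.1 q.2)).comp ((ih (S.erase i)).prodMk (ih S))
    have h : (fun y => run u y (t :: l) S) ⁻¹' A =
        ⋃ o, ({y | choice u y S t = o} ∩ F o ⁻¹' A) := by
      ext y
      simp only [Set.mem_preimage, run, Set.mem_iUnion, Set.mem_inter_iff, Set.mem_ofPred_eq,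
        exists_eq_left', F]
    rw [h]
    exact MeasurableSet.iUnion fun o =>
      (measurableSet_choice u S t o).inter (hF o trivial)

theorem measurable_policy (u : Instance) : Measurable (policy u) :=
  measurable_run u _ _

end PerturbedGreedy

/-- The Perturbed Greedy algorithm, with independent seeds `y i`, uniform on `[0, 1]`. -/
def perturbedGreedy : Algorithm := fun u =>
  ⟨(volume : Measure (u.resources → unitInterval)).map (PerturbedGreedy.policy u),
    Measure.isProbabilityMeasure_map (PerturbedGreedy.measurable_policy u).aemeasurable⟩

/-- The distribution `D` over instances is value preserving for the instance `ν`, with respect to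
the class `𝒜` of non-anticipative algorithms: `A(ν) = 𝔼_{u ∼ D} [A(u)]` for all `A ∈ 𝒜`. -/
def IsValuePreserving [MeasurableSpace Instance] (𝒜 : Set Algorithm) (ν : Instance)
    (D : Measure Instance) : Prop :=
  ∀ A ∈ 𝒜, Integrable (fun u => A.value u) D ∧ A.value ν = ∫ u, A.value u ∂D

/-- The competitive ratio `inf_{ν ∈ 𝒱} A(ν) / OPT(ν)`. Instances with `OPT(ν) = 0`, on which every
algorithm is optimal and the ratio is undefined, do not count. -/
def competitiveRatio (A : Algorithm) (𝒱 : Set Instance) : EReal :=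
  ⨅ ν ∈ 𝒱, ⨅ _ : opt ν ≠ 0, ((A.value ν / opt ν : ℝ) : EReal)

end OnlineMatching

end

/-!
Both sides of the value-preserving identity are averages over deterministic instances, so it is
enough to show that on a deterministic instance `u` Perturbed Greedy collects at least the fraction
`1 - 1 / e` of what any non-anticipative algorithm collects (`mul_algorithm_value_le`). Applied to
an algorithm that is optimal on `ν`, and integrated over `u`, this is the bound on the ratio at `ν`.

For deterministic instances the argument is the randomized primal-dual analysis of Devanur, Jain
and Kleinberg. When Perturbed Greedy with seeds `y` matches the arrival `t` to the resource `i`,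
the reward `r i` is split into `r i * (1 - exp (y i - 1))`, the dual variable of `t`, and
`r i * exp (y i - 1)`, the dual variable of `i`; all other dual variables are `0`. The dual
variables add up to the collected reward (`valueFrom_run`). By weak duality, which for adaptive
policies is an induction on the decision tree (`Policy.mul_valueFrom_le`), it remains to see that
for every edge `(i, t)` the expected dual variables of `t` and `i` add up to at least
`r i * (1 - 1 / e)` (`dual_feasible`).

Fix all seeds except `y i`, and let `c` be the dual variable of `t` in the run without `i`, which
does not depend on `y i`. Adding `i` never hurts `t` (`arrivalDual_mono`), so the dual variable of
`t` is at least `c`; and `i` is matched whenever `c < r i * (1 - exp (y i - 1))`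
(`notMem_unmatched`). Integrating over `y i` gives the bound (`le_integral_seed`), because
`exp (x - 1)` is its own derivative.
-/

namespace OnlineMatching

namespace PerturbedGreedy

/-! ### The choice rule -/

theorem choice_mem {u : Instance} {y : u.resources → unitInterval} {S : Finset u.resources}
    {t : ℕ} {k : u.resources} (h : choice u y S t = some k) : k ∈ S ∧ ((k : ℕ), t) ∈ u.edges := by
  have := (List.argmax_eq_some_iff.1 h).1
  simpa [candidates] using this

/-- The choice is the maximum of the available neighbours in the strict linear order that compares
weights, and then labels (reversed). -/
theorem choice_spec {u : Instance} {y : u.resources → unitInterval} {S : Finset u.resources}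
    {t : ℕ} {k a : u.resources} (h : choice u y S t = some k) (ha : a ∈ S)
    (he : ((a : ℕ), t) ∈ u.edges) :
    weight u y t a < weight u y t k ∨ (weight u y t a = weight u y t k ∧ k ≤ a) := by
  obtain ⟨hk, hmax, htie⟩ := List.argmax_eq_some_iff.1 h
  have hac : a ∈ candidates u S t := by simp [candidates, ha, he]
  rcases (hmax a hac).lt_or_eq with hlt | heq
  · exact Or.inl hlt
  · refine Or.inr ⟨heq, ?_⟩
    have hidx := htie a hac heq.ge
    have hs : (candidates u S t).SortedLE := (Finset.sortedLT_sort _).sortedLE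
    have hlen := @List.idxOf_lt_length_of_mem _ _ instBEqOfDecidableEq _ _ hac
    have := hs.getElem_le_getElem_of_le (hi := hidx.trans_lt hlen) (hj := hlen) hidx
    simpa using this

theorem choice_ne_none {u : Instance} {y : u.resources → unitInterval} {S : Finset u.resources}
    {t : ℕ} {a : u.resources} (ha : a ∈ S) (he : ((a : ℕ), t) ∈ u.edges) :
    choice u y S t ≠ none := by
  intro h
  have hac : a ∈ candidates u S t := by simp [candidates, ha, he]
  rw [choice, List.argmax_eq_none] at h
  simp [h] at hac

theorem choice_eq_some_iff {u : Instance} {y : u.resources → unitInterval}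
    {S : Finset u.resources} {t : ℕ} {k : u.resources} :
    choice u y S t = some k ↔ k ∈ S ∧ ((k : ℕ), t) ∈ u.edges ∧
      ∀ a ∈ S, ((a : ℕ), t) ∈ u.edges →
        weight u y t a < weight u y t k ∨ (weight u y t a = weight u y t k ∧ k ≤ a) := by
  refine ⟨fun h => ⟨(choice_mem h).1, (choice_mem h).2, fun a => choice_spec h⟩, ?_⟩
  rintro ⟨hk, he, hmax⟩
  obtain ⟨k', hk'⟩ := Option.ne_none_iff_exists'.1 (choice_ne_none (y := y) hk he)
  have h1 := choice_spec hk' hk he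
  have h2 := hmax k' (choice_mem hk').1 (choice_mem hk').2
  rw [hk', Option.some_inj]
  rcases h1 with h1 | ⟨h1, h1'⟩ <;> rcases h2 with h2 | ⟨h2, h2'⟩
  · exact absurd h1 h2.not_gt
  · exact absurd h2.symm h1.ne
  · exact absurd h1.symm h2.ne
  · exact le_antisymm h1' h2'

theorem choice_of_subset {u : Instance} {y : u.resources → unitInterval}
    {S S' : Finset u.resources} (hS : S' ⊆ S) {t : ℕ} {k : u.resources}
    (h : choice u y S t = some k) (hk : k ∈ S') : choice u y S' t = some k :=
  choice_eq_some_iff.2 ⟨hk, (choice_mem h).2, fun _ ha he => choice_spec h (hS ha) he⟩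

theorem choice_congr {u : Instance} {y y' : u.resources → unitInterval}
    {S : Finset u.resources} (hy : ∀ i ∈ S, y i = y' i) (t : ℕ) :
    choice u y S t = choice u y' S t := by
  have hw : ∀ i ∈ S, weight u y t i = weight u y' t i := fun i hi => by simp [weight, hy i hi]
  refine Option.ext fun k => ?_
  rw [choice_eq_some_iff, choice_eq_some_iff]
  refine and_congr_right fun hk => and_congr_right fun _ => forall₂_congr fun a ha => ?_
  rw [hw a ha, hw k hk]

/-! ### The available resources and the dual variables along a run -/

/-- The available resources after the resource `o`, if any, has been matched successfully. -/
def remove {u : Instance} (S : Finset u.resources) (o : Option u.resources) :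
    Finset u.resources :=
  o.elim S S.erase

/-- The resources still available after Perturbed Greedy with seeds `y` has processed a list of
arrivals, starting from the available set `S`, if every offer succeeds. -/
noncomputable def unmatched (u : Instance) (y : u.resources → unitInterval) :
    List ℕ → Finset u.resources → Finset u.resources
  | [], S => S
  | t :: l, S => unmatched u y l (remove S (choice u y S t))

/-- The part `r i * (1 - exp (y i - 1))` of the reward `r i` that is credited to an arrival which
is matched to `i`; it is `0` for an arrival without a match. -/
noncomputable def utility (u : Instance) (y : u.resources → unitInterval) (o : Option u.resources) : ℝ :=
  o.elim 0 fun i => u.r i * (1 - Real.exp ((y i : ℝ) - 1))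

/-- The dual variable of the arrival `t`: its utility when it is reached in the list of arrivals,
starting from the available set `S`, if every offer succeeds. -/
noncomputable def arrivalDual (u : Instance) (y : u.resources → unitInterval) (t : ℕ) :
    List ℕ → Finset u.resources → ℝ
  | [], _ => 0
  | a :: l, S =>
    if a = t then utility u y (choice u y S t)
    else arrivalDual u y t l (remove S (choice u y S a))

/-- The dual variable of the resource `i`: the remaining part `r i * exp (y i - 1)` of its reward
if it is matched, that is, if it is not in the set `F` of finally available resources. -/
noncomputable def resourceDual (u : Instance) (y : u.resources → unitInterval) (F : Finset u.resources)
    (i : u.resources) : ℝ :=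
  if i ∈ F then 0 else u.r i * Real.exp ((y i : ℝ) - 1)

theorem one_sub_exp_nonneg (x : unitInterval) : 0 ≤ 1 - Real.exp ((x : ℝ) - 1) := by
  have : Real.exp ((x : ℝ) - 1) ≤ 1 := Real.exp_le_one_iff.2 (by linarith [x.2.2])
  linarith

theorem utility_nonneg (u : Instance) (y : u.resources → unitInterval)
    (o : Option u.resources) : 0 ≤ utility u y o := by
  cases o with
  | none => exact le_rfl
  | some i => exact mul_nonneg (u.r_nonneg i i.2) (one_sub_exp_nonneg _)

theorem arrivalDual_nonneg (u : Instance) (y : u.resources → unitInterval) (t : ℕ) (l : List ℕ) :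
    ∀ S, 0 ≤ arrivalDual u y t l S := by
  induction l with
  | nil => intro S; exact le_rfl
  | cons a l ih =>
    intro S
    rw [arrivalDual]
    split_ifs
    · exact utility_nonneg u y _
    · exact ih _

theorem resourceDual_nonneg (u : Instance) (y : u.resources → unitInterval)
    (F : Finset u.resources) (i : u.resources) : 0 ≤ resourceDual u y F i := by
  rw [resourceDual]
  split_ifs
  · exact le_rfl
  · exact mul_nonneg (u.r_nonneg i i.2) (Real.exp_pos _).le

theorem remove_subset {u : Instance} (S : Finset u.resources) (o : Option u.resources) :
    remove S o ⊆ S := by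
  cases o with
  | none => exact subset_rfl
  | some i => exact S.erase_subset i

theorem unmatched_subset (u : Instance) (y : u.resources → unitInterval) (l : List ℕ) :
    ∀ S, unmatched u y l S ⊆ S := by
  induction l with
  | nil => intro S; exact subset_rfl
  | cons t l ih => intro S; exact (ih _).trans (remove_subset _ _)

theorem weight_eq_of_isDeterministic {u : Instance} (hu : u.IsDeterministic)
    {y : u.resources → unitInterval} {t : ℕ} {i : u.resources} (he : ((i : ℕ), t) ∈ u.edges) :
    weight u y t i = utility u y (some i) := by
  simp [weight, utility, hu _ _ he]

/-- On a deterministic instance, the reward collected by Perturbed Greedy is split between the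
arrivals and the resources without loss. -/
theorem valueFrom_run {u : Instance} (hu : u.IsDeterministic) (y : u.resources → unitInterval)
    (l : List ℕ) : ∀ (S : Finset u.resources) (used taken : Finset ℕ), l.Nodup →
      (∀ t ∈ l, t ∉ used) → (∀ i ∈ S, (i : ℕ) ∉ taken) →
      Policy.valueFrom u used taken (run u y l S) =
        ∑ t ∈ l.toFinset, arrivalDual u y t l S +
          ∑ i ∈ S, resourceDual u y (unmatched u y l S) i := by
  induction l with
  | nil =>
    intro S used taken _ _ _
    simp only [run, Policy.valueFrom, List.toFinset_nil, Finset.sum_empty, zero_add, unmatched]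
    exact (Finset.sum_eq_zero fun i hi => by simp [resourceDual, hi]).symm
  | cons a l ih =>
    intro S used taken hl hused htaken
    obtain ⟨hal, hl⟩ := List.nodup_cons.1 hl
    have hsum : ∑ t ∈ (a :: l).toFinset, arrivalDual u y t (a :: l) S =
        utility u y (choice u y S a) +
          ∑ t ∈ l.toFinset, arrivalDual u y t l (remove S (choice u y S a)) := by
      rw [List.toFinset_cons, Finset.sum_insert (by simpa using hal)]
      congr 1
      · simp [arrivalDual]
      · refine Finset.sum_congr rfl fun t ht => ?_
        have : a ≠ t := by rintro rfl; exact hal (by simpa using ht)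
        simp [arrivalDual, this]
    rw [hsum]
    rcases hc : choice u y S a with _ | k
    · simp only [run, hc, unmatched, remove, utility, Option.elim, zero_add]
      exact ih S used taken hl (fun t ht => hused t (List.mem_cons_of_mem _ ht)) htaken
    · obtain ⟨hk, he⟩ := choice_mem hc
      have hp : Policy.successProb u used taken k a = 1 := by
        rw [Policy.successProb, if_pos ⟨he, hused a List.mem_cons_self, htaken k hk⟩, hu _ _ he]
      simp only [run, hc, Policy.valueFrom, hp, unmatched, remove, utility, Option.elim]
      rw [ih (S.erase k) (insert a used) (insert (k : ℕ) taken) hl, ← Finset.add_sum_erase S _ hk]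
      · have hkF : k ∉ unmatched u y l (S.erase k) := fun h =>
          S.notMem_erase k (unmatched_subset u y l _ h)
        simp only [resourceDual, hkF, if_false]
        ring
      · intro t ht
        simp only [Finset.mem_insert, not_or]
        exact ⟨by rintro rfl; exact hal ht, hused t (List.mem_cons_of_mem _ ht)⟩
      · intro i hi
        obtain ⟨hik, hiS⟩ := Finset.mem_erase.1 hi
        simp only [Finset.mem_insert, not_or]
        exact ⟨fun h => hik (Subtype.ext h), htaken i hiS⟩

theorem policy_value {u : Instance} (hu : u.IsDeterministic) (y : u.resources → unitInterval) :
    (policy u y).value u =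
      ∑ t ∈ u.arrivals, arrivalDual u y t (u.arrivals.sort (· ≤ ·)) Finset.univ +
        ∑ i, resourceDual u y (unmatched u y (u.arrivals.sort (· ≤ ·)) Finset.univ) i := by
  rw [Policy.value, policy, valueFrom_run hu y _ _ _ _ (Finset.sort_nodup _ _) (by simp) (by simp),
    Finset.sort_toFinset]

/-! ### Monotonicity and dominance -/

/-- Making more resources available never decreases the set of resources available later. -/
theorem remove_choice_mono (u : Instance) (y : u.resources → unitInterval)
    {S S' : Finset u.resources} (hS : S' ⊆ S) (t : ℕ) :
    remove S' (choice u y S' t) ⊆ remove S (choice u y S t) := by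
  rcases hc : choice u y S t with _ | k
  · exact (remove_subset _ _).trans hS
  · by_cases hk : k ∈ S'
    · rw [choice_of_subset hS hc hk]
      exact Finset.erase_subset_erase k hS
    · refine (remove_subset _ _).trans fun j hj => Finset.mem_erase.2 ⟨?_, hS hj⟩
      rintro rfl
      exact hk hj

theorem utility_choice_mono {u : Instance} (hu : u.IsDeterministic)
    (y : u.resources → unitInterval) {S S' : Finset u.resources} (hS : S' ⊆ S) (t : ℕ) :
    utility u y (choice u y S' t) ≤ utility u y (choice u y S t) := by
  rcases hc' : choice u y S' t with _ | k'
  · exact utility_nonneg u y _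
  · obtain ⟨hk', he'⟩ := choice_mem hc'
    obtain ⟨k, hc⟩ := Option.ne_none_iff_exists'.1 (choice_ne_none (y := y) (hS hk') he')
    rw [hc, ← weight_eq_of_isDeterministic hu he',
      ← weight_eq_of_isDeterministic hu (choice_mem hc).2]
    rcases choice_spec hc (hS hk') he' with h | h
    exacts [h.le, h.1.le]

theorem arrivalDual_mono {u : Instance} (hu : u.IsDeterministic)
    (y : u.resources → unitInterval) (t : ℕ) (l : List ℕ) :
    ∀ {S S' : Finset u.resources}, S' ⊆ S →
      arrivalDual u y t l S' ≤ arrivalDual u y t l S := by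
  induction l with
  | nil => intro S S' _; exact le_rfl
  | cons a l ih =>
    intro S S' hS
    rw [arrivalDual, arrivalDual]
    split_ifs
    · exact utility_choice_mono hu y hS t
    · exact ih (remove_choice_mono u y hS a)

theorem arrivalDual_congr {u : Instance} {y y' : u.resources → unitInterval} (t : ℕ)
    (l : List ℕ) : ∀ {S : Finset u.resources}, (∀ i ∈ S, y i = y' i) →
      arrivalDual u y t l S = arrivalDual u y' t l S := by
  induction l with
  | nil => intro S _; rfl
  | cons a l ih =>
    intro S hy
    rw [arrivalDual, arrivalDual]
    split_ifs
    · rw [← choice_congr hy t]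
      rcases hc : choice u y S t with _ | k
      · rfl
      · simp [utility, hy k (choice_mem hc).1]
    · rw [← choice_congr hy a]
      exact ih fun i hi => hy i (remove_subset _ _ hi)

/-- Dominance: if the utility of `t` in the run without its neighbour `i` is less than what `i`
would offer to `t`, then `i` is matched in the run with `i`. As long as `i` is available, the two
runs make the same choices; so if `i` were still available at `t`, then `t` would choose `i`. -/
theorem notMem_unmatched {u : Instance} (hu : u.IsDeterministic)
    (y : u.resources → unitInterval) {t : ℕ} {i : u.resources} (he : ((i : ℕ), t) ∈ u.edges)
    (l : List ℕ) : ∀ {S : Finset u.resources}, t ∈ l →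
      arrivalDual u y t l (S.erase i) < utility u y (some i) → i ∉ unmatched u y l S := by
  induction l with
  | nil => intro S ht; simp at ht
  | cons a l ih =>
    intro S ht hlt hi
    have hiR := unmatched_subset u y l _ hi
    have hiS : i ∈ S := remove_subset _ _ hiR
    rw [arrivalDual] at hlt
    have hci : choice u y S a ≠ some i := by
      intro h
      rw [h] at hiR
      exact S.notMem_erase i hiR
    have hmem : ∀ k, choice u y S a = some k → choice u y (S.erase i) a = some k := fun k hk =>
      choice_of_subset (S.erase_subset i) hk
        (Finset.mem_erase.2 ⟨by rintro rfl; exact hci hk, (choice_mem hk).1⟩)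
    split_ifs at hlt with hat
    · subst hat
      obtain ⟨k, hk⟩ := Option.ne_none_iff_exists'.1 (choice_ne_none (y := y) hiS he)
      rw [hmem k hk, ← weight_eq_of_isDeterministic hu he,
        ← weight_eq_of_isDeterministic hu (choice_mem hk).2] at hlt
      rcases choice_spec hk hiS he with h | h
      exacts [hlt.not_gt h, hlt.ne' h.1]
    · refine ih ((List.mem_cons.1 ht).resolve_left (Ne.symm hat)) ?_ hi
      convert hlt using 2
      rcases hc : choice u y S a with _ | k
      · rcases hc' : choice u y (S.erase i) a with _ | k'
        · rfl
        · exact absurd hc (choice_ne_none (Finset.mem_of_mem_erase (choice_mem hc').1)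
            (choice_mem hc').2)
      · rw [hmem k hc]
        exact Finset.erase_right_comm


/-! ### Measurability of the dual variables -/

theorem measurable_of_choice {β : Type*} [MeasurableSpace β] (u : Instance)
    (S : Finset u.resources) (t : ℕ)
    {F : Option u.resources → (u.resources → unitInterval) → β} (hF : ∀ o, Measurable (F o)) :
    Measurable fun y => F (choice u y S t) y := by
  intro A hA
  have h : (fun y => F (choice u y S t) y) ⁻¹' A =
      ⋃ o, ({y | choice u y S t = o} ∩ F o ⁻¹' A) := by
    ext y
    simp
  rw [h]
  exact MeasurableSet.iUnion fun o => (measurableSet_choice u S t o).inter (hF o hA)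

theorem measurable_utility (u : Instance) (o : Option u.resources) :
    Measurable fun y => utility u y o := by
  cases o with
  | none => exact measurable_const
  | some i =>
    simp only [utility, Option.elim]
    fun_prop

theorem measurable_arrivalDual (u : Instance) (t : ℕ) (l : List ℕ) :
    ∀ S, Measurable fun y => arrivalDual u y t l S := by
  induction l with
  | nil => intro S; exact measurable_const
  | cons a l ih =>
    intro S
    simp only [arrivalDual]
    split_ifs
    · exact measurable_of_choice u S t (F := fun o y => utility u y o) (measurable_utility u)
    · exact measurable_of_choice u S a (F := fun o y => arrivalDual u y t l (remove S o))
        fun o => ih _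

theorem measurable_resourceDual (u : Instance) (i : u.resources) (l : List ℕ) :
    ∀ S, Measurable fun y => resourceDual u y (unmatched u y l S) i := by
  induction l with
  | nil =>
    intro S
    by_cases hi : i ∈ S
    · simp only [unmatched, resourceDual, hi, if_true]
      exact measurable_const
    · simp only [unmatched, resourceDual, hi, if_false]
      fun_prop
  | cons a l ih =>
    intro S
    exact measurable_of_choice u S a
      (F := fun o y => resourceDual u y (unmatched u y l (remove S o)) i) fun o => ih _

theorem utility_le (u : Instance) (y : u.resources → unitInterval) (o : Option u.resources) :
    utility u y o ≤ ∑ i : u.resources, u.r i := by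
  cases o with
  | none => exact Finset.sum_nonneg fun i _ => u.r_nonneg i i.2
  | some i =>
    calc u.r i * (1 - Real.exp ((y i : ℝ) - 1)) ≤ u.r i * 1 :=
          mul_le_mul_of_nonneg_left (by linarith [Real.exp_pos ((y i : ℝ) - 1)])
            (u.r_nonneg i i.2)
      _ = u.r i := mul_one _
      _ ≤ ∑ i : u.resources, u.r i :=
          Finset.single_le_sum (f := fun i : u.resources => u.r i)
            (fun i _ => u.r_nonneg i i.2) (Finset.mem_univ i)

theorem arrivalDual_le (u : Instance) (y : u.resources → unitInterval) (t : ℕ) (l : List ℕ) :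
    ∀ S, arrivalDual u y t l S ≤ ∑ i : u.resources, u.r i := by
  induction l with
  | nil => intro S; exact Finset.sum_nonneg fun i _ => u.r_nonneg i i.2
  | cons a l ih =>
    intro S
    rw [arrivalDual]
    split_ifs
    · exact utility_le u y _
    · exact ih _

theorem resourceDual_le (u : Instance) (y : u.resources → unitInterval)
    (F : Finset u.resources) (i : u.resources) : resourceDual u y F i ≤ u.r i := by
  rw [resourceDual]
  split_ifs
  · exact u.r_nonneg i i.2
  · exact mul_le_of_le_one_right (u.r_nonneg i i.2) (by linarith [one_sub_exp_nonneg (y i)])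

theorem integrable_arrivalDual (u : Instance) (t : ℕ) (l : List ℕ) (S : Finset u.resources) :
    Integrable fun y => arrivalDual u y t l S := by
  refine Integrable.of_bound (measurable_arrivalDual u t l S).aestronglyMeasurable
    (∑ i : u.resources, u.r i) (ae_of_all _ fun y => ?_)
  rw [Real.norm_of_nonneg (arrivalDual_nonneg u y t l S)]
  exact arrivalDual_le u y t l S

theorem integrable_resourceDual (u : Instance) (i : u.resources) (l : List ℕ)
    (S : Finset u.resources) :
    Integrable fun y => resourceDual u y (unmatched u y l S) i := by
  refine Integrable.of_bound (measurable_resourceDual u i l S).aestronglyMeasurable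
    (u.r i) (ae_of_all _ fun y => ?_)
  rw [Real.norm_of_nonneg (resourceDual_nonneg u y _ i)]
  exact resourceDual_le u y _ i

/-! ### Dual feasibility in expectation -/

theorem integrable_seed {r : ℝ} (hr : 0 ≤ r) (c : ℝ) :
    Integrable fun x : unitInterval =>
      if c < r * (1 - Real.exp ((x : ℝ) - 1)) then r * Real.exp ((x : ℝ) - 1) else 0 := by
  refine Integrable.of_bound (Measurable.aestronglyMeasurable ?_) r (ae_of_all _ fun x => ?_)
  · exact Measurable.ite (measurableSet_lt measurable_const (by fun_prop)) (by fun_prop)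
      measurable_const
  · split_ifs
    · rw [Real.norm_of_nonneg (by positivity)]
      exact mul_le_of_le_one_right hr (by linarith [one_sub_exp_nonneg x])
    · simpa using hr

/-- Integrating over the seed `x` of a resource of reward `r`: here `c` is the utility of a
neighbouring arrival in the run without the resource, and the second summand is a lower bound for
the dual variable of the resource, which is matched as soon as `r * (1 - exp (x - 1))`
exceeds `c`. -/
theorem le_integral_seed {r c : ℝ} (hr : 0 ≤ r) (hc : 0 ≤ c) :
    r * (1 - 1 / Real.exp 1) ≤ ∫ x : unitInterval,
      (c + if c < r * (1 - Real.exp ((x : ℝ) - 1)) then r * Real.exp ((x : ℝ) - 1) else 0) := by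
  rw [integral_add (integrable_const c) (integrable_seed hr c)]
  simp only [integral_const, probReal_univ, one_smul]
  have he : 1 / Real.exp 1 = Real.exp (-1) := by rw [Real.exp_neg, one_div]
  rw [he]
  rcases le_or_gt (r * (1 - Real.exp (-1))) c with h | h
  · refine h.trans (le_add_of_nonneg_right (integral_nonneg fun x => ?_))
    simp only [Pi.zero_apply]
    split_ifs <;> positivity
  · have hr0 : 0 < r := by
      rcases hr.eq_or_lt with rfl | h0
      · simp at h; linarith
      · exact h0
    have hpos : 0 < 1 - c / r := by
      have : c / r < 1 - Real.exp (-1) := by rw [div_lt_iff₀ hr0]; linarith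
      linarith [Real.exp_pos (-1)]
    -- The critical seed: the point `z` at which `r * (1 - exp (z - 1)) = c`.
    set z : ℝ := 1 + Real.log (1 - c / r) with hz
    have hexp : Real.exp (z - 1) = 1 - c / r := by
      rw [hz, add_sub_cancel_left, Real.exp_log hpos]
    have hz0 : 0 ≤ z := by
      have : Real.exp (-1) ≤ Real.exp (z - 1) := by
        rw [hexp, le_sub_comm, div_le_iff₀ hr0]; linarith
      linarith [Real.exp_le_exp.1 this]
    have hz1 : z ≤ 1 := by
      have : Real.exp (z - 1) ≤ Real.exp 0 := by
        rw [hexp, Real.exp_zero]; linarith [div_nonneg hc hr]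
      linarith [Real.exp_le_exp.1 this]
    have hiff : ∀ x : ℝ, c < r * (1 - Real.exp (x - 1)) ↔ x < z := by
      intro x
      have hcz : c = r * (1 - Real.exp (z - 1)) := by rw [hexp]; field_simp; ring
      rw [hcz, mul_lt_mul_iff_right₀ hr0, sub_lt_sub_iff_left, Real.exp_lt_exp,
        sub_lt_sub_iff_right]
    have hint : ∫ x : unitInterval, (if c < r * (1 - Real.exp ((x : ℝ) - 1)) then
        r * Real.exp ((x : ℝ) - 1) else 0) = r - c - r * Real.exp (-1) := by
      calc ∫ x : unitInterval, (if c < r * (1 - Real.exp ((x : ℝ) - 1)) then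
              r * Real.exp ((x : ℝ) - 1) else 0)
          = ∫ x : unitInterval, (Set.Iio z).indicator (fun x => r * Real.exp (x - 1)) (x : ℝ) := by
            refine integral_congr_ae (ae_of_all _ fun x => ?_)
            simp only [Set.indicator, Set.mem_Iio, hiff]
        _ = ∫ x in Set.Icc (0 : ℝ) 1, (Set.Iio z).indicator (fun x => r * Real.exp (x - 1)) x :=
            unitInterval.measurePreserving_coe.integral_comp
              unitInterval.measurableEmbedding_coe _
        _ = ∫ x in Set.Ico (0 : ℝ) z, r * Real.exp (x - 1) := by
            rw [setIntegral_indicator measurableSet_Iio]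
            congr 2
            ext x
            simp only [Set.mem_inter_iff, Set.mem_Icc, Set.mem_Iio, Set.mem_Ico]
            constructor
            · rintro ⟨⟨h0, -⟩, h1⟩; exact ⟨h0, h1⟩
            · rintro ⟨h0, h1⟩; exact ⟨⟨h0, h1.le.trans hz1⟩, h1⟩
        _ = ∫ x in (0 : ℝ)..z, r * Real.exp (x - 1) := by
            rw [integral_Ico_eq_integral_Ioc, intervalIntegral.integral_of_le hz0]
        _ = r * (Real.exp (z - 1) - Real.exp (0 - 1)) := by
            rw [intervalIntegral.integral_const_mul,
              intervalIntegral.integral_comp_sub_right (fun x => Real.exp x), integral_exp]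
        _ = r - c - r * Real.exp (-1) := by
            rw [hexp, zero_sub]; field_simp
    rw [hint]
    linarith

/-- A lower bound on the integral over one seed, valid for all values of the other seeds, is a
lower bound on the expectation. -/
theorem le_integral_of_forall_update {ι : Type*} [Fintype ι] [DecidableEq ι]
    {F : (ι → unitInterval) → ℝ} (hF : Measurable F) (hint : Integrable F) (h0 : ∀ y, 0 ≤ F y)
    (i : ι) {b : ℝ}
    (h : ∀ y, ENNReal.ofReal b ≤ ∫⁻ x, ENNReal.ofReal (F (Function.update y i x))) :
    b ≤ ∫ y, F y := by
  have hle := lintegral_le_of_lmarginal_le (μ := fun _ : ι => (volume : Measure unitInterval)) {i}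
    (f := fun _ => ENNReal.ofReal b) (g := fun y => ENNReal.ofReal (F y))
    measurable_const hF.ennreal_ofReal (by
      intro y
      simp only [lmarginal_singleton]
      simpa using h y)
  rw [← volume_pi, ← ofReal_integral_eq_lintegral_ofReal hint (ae_of_all _ h0)] at hle
  rw [← ENNReal.ofReal_le_ofReal_iff (integral_nonneg h0)]
  simpa using hle

/-- In expectation, the dual variables cover the fraction `1 - 1 / e` of every edge. -/
theorem dual_feasible {u : Instance} (hu : u.IsDeterministic) {t : ℕ} {i : u.resources}
    (he : ((i : ℕ), t) ∈ u.edges) {l : List ℕ} (ht : t ∈ l) :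
    u.r i * (1 - 1 / Real.exp 1) ≤
      (∫ y, arrivalDual u y t l Finset.univ) +
        ∫ y, resourceDual u y (unmatched u y l Finset.univ) i := by
  have hA := integrable_arrivalDual u t l Finset.univ
  have hR := integrable_resourceDual u i l Finset.univ
  rw [← integral_add hA hR]
  refine le_integral_of_forall_update ((measurable_arrivalDual u t l _).add
    (measurable_resourceDual u i l _)) (hA.add hR) (fun y => add_nonneg
    (arrivalDual_nonneg u y t l _) (resourceDual_nonneg u y _ i)) i fun y => ?_
  set c := arrivalDual u y t l (Finset.univ.erase i)
  have hr := u.r_nonneg i i.2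
  have hc0 : 0 ≤ c := arrivalDual_nonneg u y t l _
  refine (ENNReal.ofReal_le_ofReal (le_integral_seed hr hc0)).trans ?_
  have hint : Integrable fun x : unitInterval =>
      c + if c < u.r i * (1 - Real.exp ((x : ℝ) - 1)) then u.r i * Real.exp ((x : ℝ) - 1) else 0 :=
    (integrable_const c).add (integrable_seed hr c)
  rw [ofReal_integral_eq_lintegral_ofReal hint
    (ae_of_all _ fun x => add_nonneg hc0 (by split_ifs <;> positivity))]
  refine lintegral_mono fun x => ENNReal.ofReal_le_ofReal ?_
  -- The run without `i` does not depend on the seed of `i`.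
  have hcx : arrivalDual u (Function.update y i x) t l (Finset.univ.erase i) = c :=
    arrivalDual_congr t l fun j hj => Function.update_of_ne (Finset.ne_of_mem_erase hj) _ _
  refine add_le_add ?_ ?_
  · rw [← hcx]
    exact arrivalDual_mono hu _ t l (Finset.erase_subset _ _)
  · split_ifs with hlt
    · have hi : i ∉ unmatched u (Function.update y i x) l Finset.univ := by
        refine notMem_unmatched hu _ he l ht ?_
        rw [hcx]
        simpa [utility] using hlt
      change _ ≤ resourceDual u (Function.update y i x) _ i
      rw [resourceDual, if_neg hi, Function.update_self]
    · exact resourceDual_nonneg u _ _ i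

end PerturbedGreedy

/-! ### Weak duality and the competitive ratio -/

namespace Policy

theorem successProb_nonneg (u : Instance) (used taken : Finset ℕ) (i t : ℕ) :
    0 ≤ successProb u used taken i t := by
  rw [successProb]
  split_ifs with h
  exacts [u.p_nonneg i t h.1, le_rfl]

theorem successProb_le_one (u : Instance) (used taken : Finset ℕ) (i t : ℕ) :
    successProb u used taken i t ≤ 1 := by
  rw [successProb]
  split_ifs with h
  exacts [u.p_le_one i t h.1, zero_le_one]

theorem valueFrom_nonneg (u : Instance) (π : Policy) :
    ∀ used taken, 0 ≤ valueFrom u used taken π := by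
  induction π with
  | halt => intro used taken; exact le_rfl
  | offer i t s f hs hf =>
    intro used taken
    rw [valueFrom]
    refine add_nonneg ?_ (mul_nonneg
      (sub_nonneg.2 (successProb_le_one u used taken i t)) (hf _ _))
    by_cases he : (i, t) ∈ u.edges
    · exact mul_nonneg (successProb_nonneg u used taken i t) (add_nonneg
        (u.r_nonneg i (Finset.mem_product.1 (u.edges_subset he)).1) (hs _ _))
    · simp [successProb, he]

/-- Weak duality: dual variables `a` of the resources and `b` of the arrivals that cover the
fraction `κ` of the reward of every edge bound `κ` times the value of every policy. -/
theorem mul_valueFrom_le {u : Instance} (hu : u.IsDeterministic) {κ : ℝ} {a b : ℕ → ℝ}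
    (ha : ∀ i, 0 ≤ a i) (hb : ∀ t, 0 ≤ b t)
    (hab : ∀ i t, (i, t) ∈ u.edges → u.r i * κ ≤ b t + a i) (π : Policy) :
    ∀ used taken, κ * valueFrom u used taken π ≤
      ∑ t ∈ u.arrivals \ used, b t + ∑ i ∈ u.resources \ taken, a i := by
  induction π with
  | halt =>
    intro used taken
    rw [valueFrom, mul_zero]
    exact add_nonneg (Finset.sum_nonneg fun t _ => hb t) (Finset.sum_nonneg fun i _ => ha i)
  | offer i t s f hs hf =>
    intro used taken
    rw [valueFrom]
    by_cases h : (i, t) ∈ u.edges ∧ t ∉ used ∧ i ∉ taken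
    · obtain ⟨he, ht, hi⟩ := h
      obtain ⟨hiI, htT⟩ := Finset.mem_product.1 (u.edges_subset he)
      rw [successProb, if_pos ⟨he, ht, hi⟩, hu i t he]
      have h1 := hs (insert t used) (insert i taken)
      rw [Finset.sdiff_insert, Finset.sdiff_insert] at h1
      rw [← Finset.add_sum_erase _ b (Finset.mem_sdiff.2 ⟨htT, ht⟩),
        ← Finset.add_sum_erase _ a (Finset.mem_sdiff.2 ⟨hiI, hi⟩)]
      linarith [hab i t he]
    · rw [successProb, if_neg h]
      simp only [zero_mul, zero_add, sub_zero, one_mul]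
      refine (hf _ _).trans (add_le_add_left (Finset.sum_le_sum_of_subset_of_nonneg
        (Finset.sdiff_subset_sdiff subset_rfl (Finset.subset_insert t used))
        fun t _ _ => hb t) _)

end Policy

theorem perturbedGreedy_value {u : Instance} (hu : u.IsDeterministic) :
    perturbedGreedy.value u =
      ∑ t ∈ u.arrivals,
        (∫ y, PerturbedGreedy.arrivalDual u y t (u.arrivals.sort (· ≤ ·)) Finset.univ) +
      ∑ i, ∫ y, PerturbedGreedy.resourceDual u y
        (PerturbedGreedy.unmatched u y (u.arrivals.sort (· ≤ ·)) Finset.univ) i := by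
  have h : perturbedGreedy.value u = ∫ y, (PerturbedGreedy.policy u y).value u :=
    integral_map (PerturbedGreedy.measurable_policy u).aemeasurable
      (Measurable.of_discrete (f := fun π : Policy => π.value u)).aestronglyMeasurable
  rw [h]
  simp only [PerturbedGreedy.policy_value hu]
  rw [integral_add, integral_finsetSum, integral_finsetSum]
  · exact fun i _ => PerturbedGreedy.integrable_resourceDual u i _ _
  · exact fun t _ => PerturbedGreedy.integrable_arrivalDual u t _ _
  · exact integrable_finsetSum _ fun t _ => PerturbedGreedy.integrable_arrivalDual u t _ _
  · exact integrable_finsetSum _ fun i _ => PerturbedGreedy.integrable_resourceDual u i _ _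

theorem mul_value_le_perturbedGreedy {u : Instance} (hu : u.IsDeterministic) (π : Policy) :
    (1 - 1 / Real.exp 1) * π.value u ≤ perturbedGreedy.value u := by
  set l := u.arrivals.sort (· ≤ ·)
  let b : ℕ → ℝ := fun t => ∫ y, PerturbedGreedy.arrivalDual u y t l Finset.univ
  let A : u.resources → ℝ := fun i =>
    ∫ y, PerturbedGreedy.resourceDual u y (PerturbedGreedy.unmatched u y l Finset.univ) i
  let a : ℕ → ℝ := fun i => if h : i ∈ u.resources then A ⟨i, h⟩ else 0
  have hA : ∀ i, 0 ≤ A i := fun i =>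
    integral_nonneg fun y => PerturbedGreedy.resourceDual_nonneg u y _ i
  have ha : ∀ i, 0 ≤ a i := by
    intro i
    simp only [a]
    split_ifs
    exacts [hA _, le_rfl]
  have hb : ∀ t, 0 ≤ b t := fun t =>
    integral_nonneg fun y => PerturbedGreedy.arrivalDual_nonneg u y t l _
  have hab : ∀ i t, (i, t) ∈ u.edges → u.r i * (1 - 1 / Real.exp 1) ≤ b t + a i := by
    intro i t he
    obtain ⟨hi, ht⟩ := Finset.mem_product.1 (u.edges_subset he)
    simp only [a, dif_pos hi]
    exact PerturbedGreedy.dual_feasible hu (i := ⟨i, hi⟩) he ((Finset.mem_sort _).2 ht)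
  have hsum : ∑ i, A i = ∑ i ∈ u.resources, a i := by
    rw [← Finset.sum_coe_sort u.resources a]
    exact Finset.sum_congr rfl fun i _ => by simp [a]
  rw [perturbedGreedy_value hu]
  have := Policy.mul_valueFrom_le hu ha hb hab π ∅ ∅
  rw [Finset.sdiff_empty, Finset.sdiff_empty, ← hsum] at this
  exact this

/-- On deterministic instances, Perturbed Greedy is `1 - 1 / e` competitive against every
non-anticipative algorithm. -/
theorem mul_algorithm_value_le {u : Instance} (hu : u.IsDeterministic) (A : Algorithm) :
    (1 - 1 / Real.exp 1) * A.value u ≤ perturbedGreedy.value u := by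
  have hκ : 0 < 1 - 1 / Real.exp 1 := by
    rw [sub_pos, div_lt_one (Real.exp_pos 1)]
    exact Real.one_lt_exp_iff.2 one_pos
  rw [Algorithm.value, randValue, ← integral_const_mul]
  calc ∫ π, (1 - 1 / Real.exp 1) * π.value u ∂(A u : Measure Policy)
      ≤ ∫ _, perturbedGreedy.value u ∂(A u : Measure Policy) :=
        integral_mono_of_nonneg
          (ae_of_all _ fun π => mul_nonneg hκ.le (Policy.valueFrom_nonneg u π ∅ ∅))
          (integrable_const _) (ae_of_all _ (mul_value_le_perturbedGreedy hu))
    _ = perturbedGreedy.value u := by simp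

theorem opt_nonneg (u : Instance) : 0 ≤ opt u :=
  Real.iSup_nonneg fun _ => integral_nonneg fun π => Policy.valueFrom_nonneg u π ∅ ∅

end OnlineMatching

theorem corollary1 [MeasurableSpace OnlineMatching.Instance]
    (𝒱 : Set OnlineMatching.Instance)
    (𝒜 : Set OnlineMatching.Algorithm)
    (hALG : OnlineMatching.perturbedGreedy ∈ 𝒜)
    (hOPT : ∀ ν ∈ 𝒱, ∃ A ∈ 𝒜, A.value ν = OnlineMatching.opt ν)
    (D : OnlineMatching.Instance → MeasureTheory.Measure OnlineMatching.Instance)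
    (hD : ∀ ν ∈ 𝒱, MeasureTheory.IsProbabilityMeasure (D ν))
    (hval : ∀ ν ∈ 𝒱, OnlineMatching.IsValuePreserving 𝒜 ν (D ν))
    (hdet : ∀ ν ∈ 𝒱, ∀ᵐ u ∂(D ν), u.IsDeterministic) :
    ((1 - 1 / Real.exp 1 : ℝ) : EReal) ≤
      OnlineMatching.competitiveRatio OnlineMatching.perturbedGreedy 𝒱 := by
  refine le_iInf₂ fun ν hν => le_iInf fun hne => EReal.coe_le_coe_iff.2 ?_
  obtain ⟨A, hA, hAopt⟩ := hOPT ν hν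
  obtain ⟨hAint, hAval⟩ := hval ν hν A hA
  obtain ⟨hGint, hGval⟩ := hval ν hν _ hALG
  rw [le_div_iff₀ ((OnlineMatching.opt_nonneg ν).lt_of_ne' hne), ← hAopt, hAval, hGval,
    ← integral_const_mul]
  exact integral_mono_ae (hAint.const_mul _) hGint
    ((hdet ν hν).mono fun u hu => OnlineMatching.mul_algorithm_value_le hu A)
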